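/- Let $\mathcal E\subseteq\mathbb R^2$ be a measurable environment containing a compact starting region $\mathcal S$, a compact destination region $\mathcal D$ and a measurable obstacle region $\Delta$, pairwise disjoint, such that every line segment between two points of $\mathcal S\cup\mathcal D$ lies in $\mathcal E$ (e.g. $\mathcal E$ convex). There are $n\ge 1$ agents $A_1,\dots,A_n$; $A_i$ is a disk of radius $r_i>0$ with initial position (centre) $\mathbf s_i\in\mathcal S$ and destination $\mathbf d_i\in\mathcal D$, and the priorities satisfy $\rho_1\ge\dots\ge\rho_n$. Put $\hat r=\max_i r_i$. Assume that the closed disks $B(\mathbf s_i,r_i)$ are at distance at least $2\hat r$ from each other and from $\partial\mathcal S$, and likewise that the closed disks $B(\mathbf d_i,r_i)$ are at distance at least $2\hat r$ from each other and from $\partial\mathcal D$. The components of $\mathcal S$ and of $\mathcal D$ are their path components. They are assumed to be wide enough for the agents: any two positions of a disk of radius $\hat r$ inside $\mathcal S$ whose centres lie in the same component of $\mathcal S$ can be connected by moving the disk continuously inside $\mathcal S$ (touching $\partial \mathcal S$ is allowed), and the same holds for $\mathcal D$. For sets $X,Y$ let $d_{\max}(X,Y)=\sup_{x\in X,\,y\in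 Y}\|x-y\|_2$, except that $d_{\max}(X,X)=0$ for a component $X$. Assume that $d_{\max}(S_1,S_2)+d_{\max}(D_1,D_2)\le d_{\max}(S_3,D_3)$ for all components $S_1,S_2,S_3$ of $\mathcal S$ and $D_1,D_2,D_3$ of $\mathcal D$ (not necessarily distinct). Let $\mathcal S_{A_i}$, $\mathcal D_{A_i}$ be the components that contain $\mathbf s_i$, $\mathbf d_i$, and put $d_{A_1}=d_{\max}(\mathcal S_{A_1},\mathcal D_{A_1})$ and, for $i\ge2$, $d_{A_i,\mathcal S}=\min_{j<i}d_{\max}(\mathcal S_{A_i},\mathcal S_{A_j})$, $d_{A_i,\mathcal D}=\min_{j<i}d_{\max}(\mathcal D_{A_i},\mathcal D_{A_j})$. Let $C_i=d_{A_1}+\sum_{j=2}^i(d_{A_j,\mathcal S}+d_{A_j,\mathcal D})$. Then the following hold. 1. If $$|\mathcal E\setminus(\Delta\cup\mathcal S\cup\mathcal D)|\ \ge\ 2d_{A_1}\hat r+\sum_{i=2}^n 2(d_{A_i,\mathcal S}+d_{A_i,\mathcal D})\hat r ,$$ then the obstacle region can be changed to a measurable region $\Delta^*\subseteq\mathcal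 E\setminus(\mathcal S\cup\mathcal D)$ of the same area, $|\Delta^*|=|\Delta|$, for which there are continuous trajectories $\mathbf p_i:[0,\infty)\to\mathbb R^2$, $i=1,\dots,n$, that start at $\mathbf s_i$, reach $\mathbf d_i$ in finite time and stay there, are collision-free (for all $t\ge0$: the open disk of radius $r_i$ around $\mathbf p_i(t)$ lies in $\mathcal E$, the distance from $\mathbf p_i(t)$ to every point of $\Delta^*$ is at least $r_i$, and $\|\mathbf p_i(t)-\mathbf p_j(t)\|_2\ge r_i+r_j$ for $i\neq j$), and along which the distance travelled by the centre of $A_i$ outside $\mathcal S\cup\mathcal D$ is at most $C_i$, for every $i$. 2. The area required in 1 is at most $2n\,d_{\max}(\mathcal S,\mathcal D)\,\hat r$, the area required without priorities. 3. $C_1\le C_2\le\dots\le C_n$; in particular $C_i\le C_j$ whenever $\rho_i>\rho_j$. -/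

import Mathlib

open Set MeasureTheory
open scoped NNReal ENNReal

namespace EnvOpt

/-- The plane with its Euclidean norm. -/
abbrev Plane : Type := EuclideanSpace ℝ (Fin 2)

/-- A two-dimensional environment `E` with compact starting region `S`, compact destination
region `D` and obstacle region `Δ`, pairwise disjoint.  The straight connection between any two
points of `S ∪ D` does not leave the environment (as in every convex environment). -/
structure IsEnvironment (E S D Δ : Set Plane) : Prop where
  measurableSet : MeasurableSet E
  measurableSet_obstacle : MeasurableSet Δ
  isCompact_start : IsCompact S
  isCompact_dest : IsCompact D
  start_subset : S ⊆ E
  dest_subset : D ⊆ E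
  obstacle_subset : Δ ⊆ E
  start_dest : Disjoint S D
  start_obstacle : Disjoint S Δ
  dest_obstacle : Disjoint D Δ
  segment_subset : ∀ x ∈ S ∪ D, ∀ y ∈ S ∪ D, segment ℝ x y ⊆ E

/-- The maximal agent radius. -/
noncomputable def maxRadius {n : ℕ} (r : Fin n → ℝ) : ℝ := ⨆ i, r i

/-- The agents, as closed disks with centres `c i` in the region `R` and radii `r i`, have mutual
distance at least twice the maximal radius, and the same distance to the boundary of `R`. -/
structure WellDistributed {n : ℕ} (R : Set Plane) (c : Fin n → Plane) (r : Fin n → ℝ) :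
    Prop where
  mem : ∀ i, c i ∈ R
  agents : ∀ i j, i ≠ j → ∀ z ∈ Metric.closedBall (c i) (r i),
    ∀ w ∈ Metric.closedBall (c j) (r j), 2 * maxRadius r ≤ dist z w
  boundary : ∀ i, ∀ z ∈ Metric.closedBall (c i) (r i), ∀ w ∈ frontier R,
    2 * maxRadius r ≤ dist z w

/-- The self-connected components of a region are its path components. -/
def components (R : Set Plane) : Set (Set Plane) :=
  {A | ∃ x ∈ R, A = pathComponentIn R x}

/-- The self-connected components of `R` are wide enough for a disk of radius `ρ`: between any two
of its positions inside `R` that lie in the same component the disk can be moved inside `R`. -/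
def WideEnough (R : Set Plane) (ρ : ℝ) : Prop :=
  ∀ x y, Metric.ball x ρ ⊆ R → Metric.ball y ρ ⊆ R → JoinedIn R x y →
    JoinedIn {z | Metric.ball z ρ ⊆ R} x y

/-- The maximal distance between points of `A` and points of `B`. -/
noncomputable def maxDist (A B : Set Plane) : ℝ := sSup (image2 dist A B)

open Classical in
/-- The distance between two components of one region: the maximal distance between their points
if they are different, and `0` from a component to itself. -/
noncomputable def compDist (A B : Set Plane) : ℝ := if A = B then 0 else maxDist A B

/-- The sum of any distance between two starting components and any distance between two
destination components is at most the distance between any starting component and any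
destination component. -/
def ComponentsSeparated (S D : Set Plane) : Prop :=
  ∀ S₁ ∈ components S, ∀ S₂ ∈ components S, ∀ D₁ ∈ components D, ∀ D₂ ∈ components D,
    ∀ S₃ ∈ components S, ∀ D₃ ∈ components D,
      compDist S₁ S₂ + compDist D₁ D₂ ≤ maxDist S₃ D₃

/-- The component of `R` that contains the position `c i` of agent `i`. -/
def agentComp {n : ℕ} (R : Set Plane) (c : Fin n → Plane) (i : Fin n) : Set Plane :=
  pathComponentIn R (c i)

/-- The distance between the starting and the destination component of the first agent. -/
noncomputable def firstDist {n : ℕ} [NeZero n] (S D : Set Plane) (s d : Fin n → Plane) : ℝ :=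
  maxDist (agentComp S s 0) (agentComp D d 0)

/-- The minimal distance between the component of agent `i` and those of the agents before it
(used for all agents but the first). -/
noncomputable def prevDist {n : ℕ} (R : Set Plane) (c : Fin n → Plane) (i : Fin n) : ℝ :=
  ⨅ j : Set.Iio i, compDist (agentComp R c i) (agentComp R c j)

/-- The free area that is required for the prioritized completeness. -/
noncomputable def prioritizedArea {n : ℕ} [NeZero n] (S D : Set Plane) (s d : Fin n → Plane)
    (r : Fin n → ℝ) : ℝ :=
  2 * firstDist S D s d * maxRadius r +
    ∑ i ∈ Finset.Ioi (0 : Fin n), 2 * (prevDist S s i + prevDist D d i) * maxRadius r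

/-- The bound on the distance that agent `i` travels outside `S` and `D`. -/
noncomputable def travelBound {n : ℕ} [NeZero n] (S D : Set Plane) (s d : Fin n → Plane)
    (i : Fin n) : ℝ :=
  firstDist S D s d + ∑ j ∈ Finset.Ioc 0 i, (prevDist S s j + prevDist D d j)

open Classical in
/-- The distance travelled along `p` outside the closed set `R`: the supremum, over all
subdivisions `u 0 ≤ u 1 ≤ ⋯ ≤ u N` of time, of the total length of the chords of those
subintervals during which `p` stays outside `R`. -/
noncomputable def lengthOutside (R : Set Plane) (p : ℝ≥0 → Plane) : ℝ≥0∞ :=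
  ⨆ (N : ℕ) (u : ℕ → ℝ≥0) (_ : Monotone u), ∑ k ∈ Finset.range N,
    if ∀ t ∈ Icc (u k) (u (k + 1)), p t ∉ R then edist (p (u k)) (p (u (k + 1))) else 0

/-- `p` carries out all navigation tasks in the environment `E` with the static obstacle region
`Δ`, without collision: every agent moves continuously from its start to its destination, where
it stays; its body stays in the environment and does not overlap with obstacles or with the body
of another agent (touching is allowed). -/
structure CarriesOutTasks {n : ℕ} (E Δ : Set Plane) (s d : Fin n → Plane) (r : Fin n → ℝ)
    (p : Fin n → ℝ≥0 → Plane) : Prop where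
  continuous : ∀ i, Continuous (p i)
  start : ∀ i, p i 0 = s i
  arrive : ∀ i, ∃ T, ∀ t, T ≤ t → p i t = d i
  inside : ∀ i t, Metric.ball (p i t) (r i) ⊆ E
  obstacle : ∀ i t, ∀ z ∈ Δ, r i ≤ dist (p i t) z
  agents : ∀ i j, i ≠ j → ∀ t, r i + r j ≤ dist (p i t) (p j t)

end EnvOpt

/-! The agents move one after another, so it suffices to give each agent a path past the others, all
of which rest at starts or destinations. Join the starts into a tree: each `s i` with `i ≠ 0` is
linked to an earlier `s j` attaining the minimum in `prevDist`. Do the same for the destinations,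
and join the two roots by the segment from `s 0` to `d 0`.

Each link between different components gets a straight tube of radius `maxRadius r`; inside one
component `WideEnough` supplies a free move. A tube without its end disks, which lie in `S ∪ D`, has
area at most twice its length times its radius (`volume_tube_le`). The tubes therefore occupy at
most `prioritizedArea` outside `S ∪ D`, and obstacles of the original total area still fit beside
them (`exists_obstacle`).

Agent `i` climbs to `s 0`, crosses to `d 0` and descends to `d i`. Parents have smaller indices, so
each link with index in `(0, i]` is paid at most once per tree (`travels_to_first`), which gives
`travelBound`. Resting agents are bypassed along circles inside `S ∪ D`, at no cost (`avoid_balls`).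
-/

namespace EnvOpt

/-! ### Paths with bounded length outside a region -/

section

/-- There is a path from `x` to `y` in `F` that travels at most the distance `L` outside `R`.
The distance travelled up to a given time is bounded by a monotone function `f`. -/
def Travels (F R : Set Plane) (x y : Plane) (L : ℝ) : Prop :=
  ∃ (T : ℝ) (γ : ℝ → Plane) (f : ℝ → ℝ), 0 ≤ T ∧ Continuous γ ∧ (∀ t, γ t ∈ F) ∧
    (∀ t ≤ 0, γ t = x) ∧ (∀ t, T ≤ t → γ t = y) ∧ Monotone f ∧ (∀ t, 0 ≤ f t) ∧ (∀ t, f t ≤ L) ∧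
    ∀ a b, a ≤ b → (∀ t ∈ Icc a b, γ t ∉ R) → dist (γ a) (γ b) ≤ f b - f a

variable {F R : Set Plane} {x y z : Plane} {L L₁ L₂ : ℝ}

theorem Travels.symm (h : Travels F R x y L) : Travels F R y x L := by
  obtain ⟨T, γ, f, hT, hγ, hF, h0, h1, hf, hf0, hfL, hc⟩ := h
  refine ⟨T, fun t => γ (T - t), fun t => L - f (T - t), hT, by fun_prop, fun t => hF _,
    fun t ht => h1 _ (by linarith), fun t ht => h0 _ (by linarith),
    fun a b hab => ?_, fun t => ?_, fun t => ?_, fun a b hab hR => ?_⟩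
  · have := hf (show T - b ≤ T - a by linarith)
    simp only; linarith
  · have := hfL (T - t); simp only; linarith
  · have := hf0 (T - t); simp only; linarith
  · have := hc (T - b) (T - a) (by linarith) (fun t ht => by
      simpa using hR (T - t) ⟨by linarith [ht.2], by linarith [ht.1]⟩)
    rw [dist_comm]; linarith

theorem Travels.mono {F' : Set Plane} (h : Travels F R x y L₁) (hF : F ⊆ F') (hL : L₁ ≤ L₂) :
    Travels F' R x y L₂ := by
  obtain ⟨T, γ, f, hT, hγ, hF', h0, h1, hf, hf0, hfL, hc⟩ := h
  exact ⟨T, γ, f, hT, hγ, fun t => hF (hF' t), h0, h1, hf, hf0, fun t => (hfL t).trans hL, hc⟩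

theorem Travels.trans (h : Travels F R x y L₁) (h' : Travels F R y z L₂) (hy : y ∈ R) :
    Travels F R x z (L₁ + L₂) := by
  obtain ⟨T, γ, f, hT, hγ, hF, h0, h1, hf, hf0, hfL, hc⟩ := h
  obtain ⟨T', γ', f', hT', hγ', hF', h0', h1', hf', hf0', hfL', hc'⟩ := h'
  refine ⟨T + T', fun t => if t ≤ T then γ t else γ' (t - T), fun t => f t + f' (t - T),
    by linarith, ?_, fun t => ?_, fun t ht => ?_, fun t ht => ?_, fun a b hab => ?_,
    fun t => add_nonneg (hf0 _) (hf0' _), fun t => add_le_add (hfL _) (hfL' _),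
    fun a b hab hR => ?_⟩
  · refine Continuous.if_le hγ (by fun_prop) continuous_id continuous_const ?_
    rintro t rfl
    rw [h1 t le_rfl, h0' _ (by simp)]
  · simp only; split_ifs
    exacts [hF _, hF' _]
  · simp only; rw [if_pos (by linarith), h0 t ht]
  · simp only; split_ifs with hle
    · have : t = T := by linarith
      rw [h1 t this.ge, ← h1' (t - T) (by linarith), h0' (t - T) (by linarith)]
    · exact h1' _ (by linarith)
  · have := hf' (show a - T ≤ b - T by linarith)
    have := hf hab
    simp only; linarith
  · have hab1 := hf hab
    have hab2 := hf' (show a - T ≤ b - T by linarith)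
    rcases le_or_gt T b with hb | hb
    · rcases le_or_gt a T with ha | ha
      -- An interval across the junction contains time `T`, when the path is at `y ∈ R`, so it never
      -- counts.
      · exact absurd (by simpa [h1 T le_rfl] using hy) (hR T ⟨ha, hb⟩)
      · have := hc' (a - T) (b - T) (by linarith) (fun t ht => by
          have := hR (t + T) ⟨by linarith [ht.1], by linarith [ht.2]⟩
          simp only at this
          rwa [if_neg (by linarith [ht.1]), add_sub_cancel_right] at this)
        simp only
        rw [if_neg (by linarith), if_neg (by linarith)]
        linarith
    · have := hc a b hab (fun t ht => by
          have := hR t ht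
          simp only at this
          rwa [if_pos (by linarith [ht.2])] at this)
      simp only
      rw [if_pos (by linarith), if_pos (by linarith)]
      linarith

theorem Travels.segment (h : segment ℝ x y ⊆ F) : Travels F R x y (dist x y) := by
  have hcl : ∀ t : ℝ, max 0 (min t 1) ∈ Icc (0 : ℝ) 1 := fun t =>
    ⟨le_max_left _ _, max_le zero_le_one (min_le_right _ _)⟩
  refine ⟨1, fun t => AffineMap.lineMap x y (max 0 (min t 1)), fun t => max 0 (min t 1) * dist x y,
    zero_le_one, ?_, fun t => h ?_, fun t ht => ?_, fun t ht => ?_, fun a b hab => ?_, fun t => ?_,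
    fun t => ?_, fun a b hab _ => ?_⟩
  · exact AffineMap.lineMap_continuous.comp (by fun_prop)
  · rw [segment_eq_image_lineMap]
    exact ⟨_, hcl t, rfl⟩
  · simp [min_le_of_left_le ht]
  · simp [min_eq_right ht]
  · simp only; gcongr
  · exact mul_nonneg (hcl t).1 dist_nonneg
  · exact mul_le_of_le_one_left dist_nonneg (hcl t).2
  · rw [dist_lineMap_lineMap, ← sub_mul, dist_comm, Real.dist_eq, abs_of_nonneg]
    rw [sub_nonneg]; gcongr

theorem Travels.of_joinedIn (h : JoinedIn (F ∩ R) x y) : Travels F R x y 0 := by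
  obtain ⟨γ, hγ⟩ := h
  have hm : ∀ t : ℝ, γ.extend t ∈ F ∩ R := fun t => by
    obtain ⟨s, hs⟩ : γ.extend t ∈ range γ := by rw [← γ.extend_range]; exact mem_range_self t
    exact hs ▸ hγ s
  exact ⟨1, γ.extend, fun _ => 0, zero_le_one, γ.continuous_extend, fun t => (hm t).1,
    fun t ht => γ.extend_of_le_zero ht, fun t ht => γ.extend_of_one_le ht, monotone_const,
    fun _ => le_rfl, fun _ => le_rfl, fun a b hab hR => absurd (hm a).2 (hR a ⟨le_rfl, hab⟩)⟩

theorem Travels.refl (hx : x ∈ F) (hR : x ∈ R) : Travels F R x x 0 :=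
  .of_joinedIn (JoinedIn.refl ⟨hx, hR⟩)

theorem isPathConnected_circle (c : Plane) {ρ : ℝ} (hρ : 0 ≤ ρ) :
    IsPathConnected (Metric.sphere c ρ) := by
  apply isPathConnected_sphere _ c hρ
  rw [← Module.finrank_eq_rank]
  simp

/-- A path can be led around a disk along its boundary circle. -/
theorem Travels.avoid_ball {c : Plane} {ρ : ℝ} (h : Travels F R x y L) (hρ : 0 ≤ ρ)
    (hs : Metric.sphere c ρ ⊆ F ∩ R) (hx : x ∉ Metric.ball c ρ) (hy : y ∉ Metric.ball c ρ) :
    Travels (F \ Metric.ball c ρ) R x y L := by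
  obtain ⟨T, γ, f, hT, hγ, hF, h0, h1, hf, hf0, hfL, hc⟩ := h
  set K : Set ℝ := γ ⁻¹' Metric.ball c ρ with hK
  have hKo : IsOpen K := Metric.isOpen_ball.preimage hγ
  rcases K.eq_empty_or_nonempty with hKe | hKn
  · exact ⟨T, γ, f, hT, hγ, fun t => ⟨hF t, fun ht => (hKe ▸ (show t ∈ K from ht) : t ∈ (∅ : Set ℝ))⟩,
      h0, h1, hf, hf0, hfL, hc⟩
  have hlow : ∀ t ∈ K, 0 ≤ t := fun t ht => by
    by_contra! hlt
    exact hx (h0 t hlt.le ▸ ht)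
  have hupp : ∀ t ∈ K, t ≤ T := fun t ht => by
    by_contra! hlt
    exact hy (h1 t hlt.le ▸ ht)
  have hbb : BddBelow K := ⟨0, hlow⟩
  have hba : BddAbove K := ⟨T, hupp⟩
  have hcl : closure K ⊆ γ ⁻¹' Metric.closedBall c ρ :=
    closure_minimal (preimage_mono Metric.ball_subset_closedBall)
      (Metric.isClosed_closedBall.preimage hγ)
  -- First entry and last exit. As `K` is open, neither time belongs to it, so both positions lie on
  -- the circle; everything in between is replaced by one arc.
  set t₁ := sInf K with ht₁
  set t₂ := sSup K with ht₂
  have hn₁ : t₁ ∉ K := fun hmem => by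
    obtain ⟨ε, hε, hb⟩ := Metric.isOpen_iff.1 hKo _ hmem
    have : t₁ - ε / 2 ∈ K := hb (by simp [abs_of_pos hε]; linarith)
    linarith [csInf_le hbb this]
  have hn₂ : t₂ ∉ K := fun hmem => by
    obtain ⟨ε, hε, hb⟩ := Metric.isOpen_iff.1 hKo _ hmem
    have : t₂ + ε / 2 ∈ K := hb (by simp [abs_of_pos hε]; linarith)
    linarith [le_csSup hba this]
  have hsp₁ : γ t₁ ∈ Metric.sphere c ρ :=
    le_antisymm (hcl (csInf_mem_closure hKn hbb)) (not_lt.1 hn₁)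
  have hsp₂ : γ t₂ ∈ Metric.sphere c ρ :=
    le_antisymm (hcl (csSup_mem_closure hKn hba)) (not_lt.1 hn₂)
  obtain ⟨k, hk⟩ := hKn
  have hlt : t₁ < t₂ := by
    refine lt_of_le_of_ne ((csInf_le hbb hk).trans (le_csSup hba hk)) fun he => hn₁ ?_
    have : k = t₁ := le_antisymm (he ▸ le_csSup hba hk) (csInf_le hbb hk)
    exact this ▸ hk
  have ht₁0 : 0 ≤ t₁ := le_csInf ⟨k, hk⟩ hlow
  have ht₂T : t₂ ≤ T := csSup_le ⟨k, hk⟩ hupp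
  obtain ⟨β, hβ⟩ := (isPathConnected_circle c hρ).joinedIn _ hsp₁ _ hsp₂
  have hβm : ∀ t : ℝ, β.extend t ∈ Metric.sphere c ρ := fun t => by
    obtain ⟨s, hs⟩ : β.extend t ∈ range β := by rw [← β.extend_range]; exact mem_range_self t
    exact hs ▸ hβ s
  set δ : ℝ → Plane := fun t =>
    if t ≤ t₁ then γ t else if t ≤ t₂ then β.extend ((t - t₁) / (t₂ - t₁)) else γ t with hδ
  have hδ₁ : ∀ t ≤ t₁, δ t = γ t := fun t ht => if_pos ht
  have hδ₂ : ∀ t, t₂ ≤ t → δ t = γ t := fun t ht => by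
    simp only [hδ]
    rw [if_neg (by linarith)]
    split_ifs with h
    · have : t = t₂ := le_antisymm h ht
      rw [this, div_self (by linarith), β.extend_one]
    · rfl
  have hδm : ∀ t ∈ Icc t₁ t₂, δ t ∈ Metric.sphere c ρ := fun t ht => by
    simp only [hδ]
    split_ifs with h h'
    · rw [le_antisymm h ht.1]; exact hsp₁
    · exact hβm _
    · exact absurd ht.2 h'
  have hcont : Continuous δ := by
    refine Continuous.if_le hγ (Continuous.if_le ?_ hγ continuous_id continuous_const ?_)
      continuous_id continuous_const ?_
    · exact β.continuous_extend.comp (by fun_prop)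
    · rintro t rfl
      rw [div_self (by linarith), β.extend_one]
    · rintro t ht
      rw [if_pos (by simpa [ht] using hlt.le), ht, sub_self, zero_div, β.extend_zero]
  refine ⟨T, δ, f, hT, hcont, fun t => ?_, fun t ht => ?_, fun t ht => ?_, hf, hf0, hfL,
    fun a b hab hR => ?_⟩
  · rcases lt_or_ge t t₁ with h | h
    · rw [hδ₁ t h.le]
      exact ⟨hF t, fun hmem => absurd (csInf_le hbb hmem) (not_le.2 h)⟩
    rcases lt_or_ge t₂ t with h' | h'
    · rw [hδ₂ t h'.le]
      exact ⟨hF t, fun hmem => absurd (le_csSup hba hmem) (not_le.2 h')⟩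
    have := hδm t ⟨h, h'⟩
    exact ⟨(hs this).1, fun hb => (Metric.mem_ball.1 hb).ne this⟩
  · rw [hδ₁ t (ht.trans ht₁0), h0 t ht]
  · rw [hδ₂ t (ht₂T.trans ht), h1 t ht]
  -- The arc lies in `R`, so an interval spent outside `R` misses it entirely and the old `f` still
  -- bounds the length.
  · have key : ∀ t ∈ Icc a b, t ∉ Icc t₁ t₂ := fun t ht hm => hR t ht (hs (hδm t hm)).2
    have heq : ∀ t ∈ Icc a b, δ t = γ t := fun t ht => by
      rcases le_or_gt t t₁ with h | h
      · exact hδ₁ t h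
      · refine hδ₂ t (not_lt.1 fun h' => key t ht ⟨h.le, h'.le⟩)
    rw [heq a ⟨le_rfl, hab⟩, heq b ⟨hab, le_rfl⟩]
    exact hc a b hab fun t ht => heq t ht ▸ hR t ht

/-- The disks can be removed one at a time because each new circle misses the disks already removed,
so a detour never spoils an earlier one. -/
theorem Travels.avoid_balls {ι : Type*} [DecidableEq ι] {c : ι → Plane} {ρ : ι → ℝ}
    (h : Travels F R x y L) (A : Finset ι) (hρ : ∀ k ∈ A, 0 ≤ ρ k)
    (hs : ∀ k ∈ A, Metric.sphere (c k) (ρ k) ⊆ F ∩ R)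
    (hd : ∀ k ∈ A, ∀ l ∈ A, k ≠ l →
      Disjoint (Metric.sphere (c k) (ρ k)) (Metric.ball (c l) (ρ l)))
    (hx : ∀ k ∈ A, x ∉ Metric.ball (c k) (ρ k)) (hy : ∀ k ∈ A, y ∉ Metric.ball (c k) (ρ k)) :
    Travels (F \ ⋃ k ∈ A, Metric.ball (c k) (ρ k)) R x y L := by
  induction A using Finset.induction_on with
  | empty => simpa using h
  | insert k A hk ih =>
    have := ih (fun l hl => hρ l (Finset.mem_insert_of_mem hl))
      (fun l hl => hs l (Finset.mem_insert_of_mem hl))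
      (fun l hl m hm => hd l (Finset.mem_insert_of_mem hl) m (Finset.mem_insert_of_mem hm))
      (fun l hl => hx l (Finset.mem_insert_of_mem hl))
      (fun l hl => hy l (Finset.mem_insert_of_mem hl))
    have hki := Finset.mem_insert_self k A
    refine (this.avoid_ball (hρ k hki) (fun z hz => ?_) (hx k hki) (hy k hki)).mono ?_ le_rfl
    · refine ⟨⟨(hs k hki hz).1, ?_⟩, (hs k hki hz).2⟩
      simp only [mem_iUnion, not_exists]
      intro l hl hzl
      exact (hd k hki l (Finset.mem_insert_of_mem hl) (fun e => hk (e ▸ hl))).le_bot ⟨hz, hzl⟩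
    · rw [Finset.set_biUnion_insert, union_comm, sdiff_sdiff]

/-- The path of a traveller, delayed by `τ`, has the required length outside `R`. -/
theorem lengthOutside_le {γ : ℝ → Plane} {f : ℝ → ℝ} (hf : Monotone f) (hf0 : ∀ t, 0 ≤ f t)
    (hfL : ∀ t, f t ≤ L)
    (hc : ∀ a b, a ≤ b → (∀ t ∈ Icc a b, γ t ∉ R) → dist (γ a) (γ b) ≤ f b - f a) (τ : ℝ) :
    lengthOutside R (fun t : ℝ≥0 => γ (t - τ)) ≤ ENNReal.ofReal L := by
  refine iSup_le fun N => iSup_le fun u => iSup_le fun hu => ?_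
  have hmono : ∀ k, f (u k - τ) ≤ f (u (k + 1) - τ) := fun k =>
    hf (sub_le_sub_right (NNReal.coe_le_coe.2 (hu k.le_succ)) _)
  calc _ ≤ ∑ k ∈ Finset.range N, ENNReal.ofReal (f (u (k + 1) - τ) - f (u k - τ)) := by
        refine Finset.sum_le_sum fun k _ => ?_
        split_ifs with h
        · rw [edist_dist]
          refine ENNReal.ofReal_le_ofReal (hc _ _
            (sub_le_sub_right (NNReal.coe_le_coe.2 (hu k.le_succ)) _) fun t ht => ?_)
          obtain ⟨w, hw⟩ : ∃ w : ℝ≥0, (w : ℝ) = t + τ :=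
            ⟨_, Real.coe_toNNReal _ ((u k).2.trans (sub_le_iff_le_add.1 ht.1))⟩
          have := h w ⟨NNReal.coe_le_coe.1 (hw ▸ sub_le_iff_le_add.1 ht.1),
            NNReal.coe_le_coe.1 (hw ▸ le_sub_iff_add_le.1 ht.2)⟩
          simpa [hw] using this
        · exact zero_le
    _ = ENNReal.ofReal (∑ k ∈ Finset.range N, (f (u (k + 1) - τ) - f (u k - τ))) :=
        (ENNReal.ofReal_sum_of_nonneg fun k _ => sub_nonneg.2 (hmono k)).symm
    _ ≤ ENNReal.ofReal L := by
        -- The increments of `f` telescope, whatever the subdivision.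
        rw [Finset.sum_range_sub (fun k => f (u k - τ))]
        exact ENNReal.ofReal_le_ofReal (by linarith [hf0 (u 0 - τ), hfL (u N - τ)])

end

/-! ### Areas of subsets and of tubes -/

section

/-- A measurable set of the plane has measurable subsets of every smaller area. -/
theorem exists_subset_volume_eq {A : Set Plane} (hA : MeasurableSet A) {v : ℝ≥0∞}
    (hv : v ≤ volume A) : ∃ B ⊆ A, MeasurableSet B ∧ volume B = v := by
  rcases hv.eq_or_lt with h | h
  · exact ⟨A, Subset.rfl, hA, h.symm⟩
  set U : ℝ → Set Plane := fun t => A ∩ Metric.closedBall 0 t with hU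
  have hUm : ∀ t, MeasurableSet (U t) := fun t => hA.inter measurableSet_closedBall
  have hmono : Monotone U := fun s t hst =>
    inter_subset_inter_right _ (Metric.closedBall_subset_closedBall hst)
  have hfin : ∀ t, volume (U t) ≠ ∞ := fun t =>
    ((measure_mono inter_subset_right).trans_lt measure_closedBall_lt_top).ne
  obtain ⟨n, hn⟩ : ∃ n : ℕ, v < volume (U n) := by
    have : (⋃ n : ℕ, U n) = A := by
      rw [← inter_iUnion, Metric.iUnion_closedBall_nat, inter_univ]
    have hm : Monotone fun n : ℕ => U n := hmono.comp Nat.mono_cast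
    rw [← this, hm.measure_iUnion] at h
    exact lt_iSup_iff.1 h
  set g : ℝ → ℝ := fun t => volume.real (U t) with hg
  set k : ℝ → ℝ := fun t => Real.pi * (max t 0) ^ 2 with hk
  have hkv : ∀ t, k t = volume.real (Metric.closedBall (0 : Plane) t) := fun t => by
    rw [measureReal_def, EuclideanSpace.volume_closedBall_fin_two, ENNReal.toReal_mul,
      ENNReal.toReal_pow, ENNReal.toReal_ofReal', mul_comm]
    simp [hk, ENNReal.toReal_ofReal Real.pi_pos.le]
  -- The part of `A` in an annulus is at most the whole annulus, so `g` inherits continuity from the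
  -- disk area `k`; the intermediate value theorem then applies.
  have hle : ∀ s t, s ≤ t → |g t - g s| ≤ |k t - k s| := fun s t hst => by
    have hsub := Metric.closedBall_subset_closedBall (x := (0 : Plane)) hst
    rw [hkv, hkv, hg, ← measureReal_sdiff (hmono hst) (hUm s) (hfin t),
      ← measureReal_sdiff hsub measurableSet_closedBall measure_closedBall_lt_top.ne,
      abs_of_nonneg measureReal_nonneg, abs_of_nonneg measureReal_nonneg]
    refine measureReal_mono (fun z hz => ⟨hz.1.2, fun h => hz.2 ⟨hz.1.1, h⟩⟩)
      ((measure_mono sdiff_subset).trans_lt measure_closedBall_lt_top).ne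
  have hle' : ∀ s t, |g t - g s| ≤ |k t - k s| := fun s t => by
    rcases le_total s t with h | h
    · exact hle s t h
    · rw [abs_sub_comm, abs_sub_comm (k t)]; exact hle t s h
  have hgc : Continuous g := by
    rw [continuous_iff_continuousAt]
    intro s
    have hkc : Continuous k := by fun_prop
    have := tendsto_iff_dist_tendsto_zero.1 (hkc.tendsto s)
    exact tendsto_iff_dist_tendsto_zero.2 (squeeze_zero (fun _ => dist_nonneg) (hle' s) this)
  have hg0 : g 0 = 0 := by
    simp [hg, hU, measureReal_def, measure_inter_null_of_null_right]
  have hvtop : v ≠ ∞ := (hn.trans_le le_top).ne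
  obtain ⟨t, -, ht⟩ := intermediate_value_Icc (Nat.cast_nonneg n : (0 : ℝ) ≤ n) hgc.continuousOn
    (show v.toReal ∈ Icc (g 0) (g n) from
      ⟨hg0.trans_le ENNReal.toReal_nonneg, ENNReal.toReal_mono (hfin _) hn.le⟩)
  exact ⟨U t, inter_subset_left, hUm t, (ENNReal.toReal_eq_toReal_iff' (hfin t) hvtop).1 ht⟩

/-- The area of a rectangle with sides of length `l` and `2 * ρ`, given in the coordinates of an
orthonormal basis. -/
theorem volume_rectangle (b : OrthonormalBasis (Fin 2) ℝ Plane) (x : Plane) (l ρ : ℝ) :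
    volume {z : Plane | b.repr (z - x) 0 ∈ Icc 0 l ∧ b.repr (z - x) 1 ∈ Icc (-ρ) ρ} =
      ENNReal.ofReal l * ENNReal.ofReal (2 * ρ) := by
  have h1 : MeasurePreserving (fun z : Plane => z - x) volume volume :=
    measurePreserving_sub_right volume x
  have h2 := (PiLp.volume_preserving_ofLp (Fin 2)).comp
    (b.measurePreserving_repr.comp h1)
  have hm : MeasurableSet (Icc (![0, -ρ] : Fin 2 → ℝ) ![l, ρ]) := measurableSet_Icc
  have h3 := h2.measure_preimage hm.nullMeasurableSet
  rw [Real.volume_Icc_pi] at h3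
  simp only [Fin.prod_univ_two, Matrix.cons_val_zero, Matrix.cons_val_one, sub_zero,
    sub_neg_eq_add, ← two_mul] at h3
  rw [← h3]
  congr 1
  ext z
  simp only [mem_ofPred_eq, mem_preimage, mem_Icc, Pi.le_def, Fin.forall_fin_two,
    Function.comp_apply, Matrix.cons_val_zero, Matrix.cons_val_one]
  tauto

theorem exists_orthonormalBasis_zero {u : Plane} (hu : ‖u‖ = 1) :
    ∃ b : OrthonormalBasis (Fin 2) ℝ Plane, b 0 = u := by
  have : Orthonormal ℝ (({0} : Set (Fin 2)).domRestrict fun _ => u) := by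
    refine ⟨fun i => hu, fun i j hij => absurd (Subsingleton.elim i j) hij⟩
  obtain ⟨b, hb⟩ := this.exists_orthonormalBasis_extension_of_card_eq (by simp)
  exact ⟨b, hb 0 rfl⟩

/-- Without its ends, the tube of radius `ρ` around a segment has at most the area of a
rectangle. -/
theorem volume_tube_le (x y : Plane) {ρ : ℝ} (hρ : 0 < ρ) :
    volume (Metric.thickening ρ (segment ℝ x y) \ (Metric.ball x ρ ∪ Metric.ball y ρ)) ≤
      ENNReal.ofReal (2 * dist x y * ρ) := by
  rcases eq_or_ne x y with rfl | hxy
  · simp [Metric.thickening_singleton]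
  have hpos : 0 < ‖y - x‖ := norm_pos_iff.2 (sub_ne_zero.2 hxy.symm)
  set l := ‖y - x‖ with hl
  obtain ⟨b, hb⟩ := exists_orthonormalBasis_zero (u := l⁻¹ • (y - x))
    (by rw [norm_smul, norm_inv, norm_norm, inv_mul_cancel₀ hpos.ne'])
  have hy0 : y - x = l • b 0 := by rw [hb, smul_smul, mul_inv_cancel₀ hpos.ne', one_smul]
  have hsq : ∀ v : Plane, ‖v‖ ^ 2 = b.repr v 0 ^ 2 + b.repr v 1 ^ 2 := fun v => by
    rw [← b.repr.norm_map, EuclideanSpace.norm_sq_eq]; simp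
  calc _ ≤ volume {z : Plane | b.repr (z - x) 0 ∈ Icc 0 l ∧ b.repr (z - x) 1 ∈ Icc (-ρ) ρ} := by
        refine measure_mono fun z hz => ?_
        obtain ⟨hz, hends⟩ := hz
        obtain ⟨w, hw, hzw⟩ := Metric.mem_thickening_iff.1 hz
        rw [segment_eq_image'] at hw
        obtain ⟨θ, hθ, rfl⟩ := hw
        have hzx : ρ ≤ ‖z - x‖ := by
          rw [← dist_eq_norm]; exact not_lt.1 fun h => hends (.inl h)
        have hzy : ρ ≤ ‖z - y‖ := by
          rw [← dist_eq_norm]; exact not_lt.1 fun h => hends (.inr h)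
        have e1 : z - (x + θ • (y - x)) = (z - x) - (θ * l) • b 0 := by
          rw [mul_smul, ← hy0]; abel
        have e2 : z - y = (z - x) - l • b 0 := by rw [← hy0]; abel
        have hco : ∀ c : ℝ, ‖(z - x) - c • b 0‖ ^ 2 =
            (b.repr (z - x) 0 - c) ^ 2 + b.repr (z - x) 1 ^ 2 := fun c => by
          rw [hsq]; simp [map_sub, map_smul]
        rw [dist_eq_norm, e1] at hzw
        rw [e2] at hzy
        have q1 := hco (θ * l)
        have q2 := hco l
        have q3 := hsq (z - x)
        have p1 : ‖(z - x) - (θ * l) • b 0‖ ^ 2 < ρ ^ 2 := by gcongr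
        have p2 : ρ ^ 2 ≤ ‖(z - x) - l • b 0‖ ^ 2 := by gcongr
        have p3 : ρ ^ 2 ≤ ‖z - x‖ ^ 2 := by gcongr
        set p := b.repr (z - x) 0
        set q := b.repr (z - x) 1
        have hθl : 0 ≤ θ * l := mul_nonneg hθ.1 hpos.le
        have hθl' : θ * l ≤ l := mul_le_of_le_one_left hpos.le hθ.2
        -- A point projecting beyond an end of the segment is nearest to that end, hence would lie
        -- in the removed end disk.
        refine ⟨⟨?_, ?_⟩, abs_le.1 (abs_le_of_sq_le_sq ?_ hρ.le)⟩
        · by_contra! hn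
          nlinarith
        · by_contra! hn
          nlinarith
        · nlinarith [sq_nonneg (p - θ * l)]
    _ = ENNReal.ofReal l * ENNReal.ofReal (2 * ρ) := volume_rectangle b x l ρ
    _ = ENNReal.ofReal (2 * dist x y * ρ) := by
        rw [← ENNReal.ofReal_mul hpos.le, dist_comm, dist_eq_norm]
        congr 1; ring

end

/-! ### Separation of agents, component distances and the tree of links -/

section

variable {F R V : Set Plane} {x y : Plane} {n : ℕ} {c : Fin n → Plane}
  {r : Fin n → ℝ}

theorem le_maxRadius (r : Fin n → ℝ) (i : Fin n) : r i ≤ maxRadius r :=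
  le_ciSup (finite_range r).bddAbove i

/-- A ball is connected, so if it left `R` it would contain a frontier point, and that point would
be closer than `2 * maxRadius r` to the body of agent `i`. -/
theorem WellDistributed.ball_subset (h : WellDistributed R c r) (hr : ∀ i, 0 < r i) (i : Fin n) :
    Metric.ball (c i) (r i + 2 * maxRadius r) ⊆ R := by
  have hm := (hr i).trans_le (le_maxRadius r i)
  intro z hz
  by_contra hzR
  have hpos : 0 < r i + 2 * maxRadius r := by linarith [hr i]
  have hpre : IsPreconnected (Metric.ball (c i) (r i + 2 * maxRadius r)) :=
    (convex_ball _ _).isPreconnected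
  obtain ⟨w, hw, hwf⟩ : (Metric.ball (c i) (r i + 2 * maxRadius r) ∩ frontier R).Nonempty := by
    by_contra hne
    have hnf : ∀ w ∈ Metric.ball (c i) (r i + 2 * maxRadius r), w ∈ closure R → w ∈ interior R :=
      fun w hw hwc => by_contra fun hwi => hne ⟨w, hw, hwc, hwi⟩
    obtain ⟨w, -, hwi, hwc⟩ := hpre _ _ isOpen_interior isClosed_closure.isOpen_compl
      (fun w hw => or_iff_not_imp_right.2 fun hwc => hnf w hw (not_not.1 hwc))
      ⟨c i, Metric.mem_ball_self hpos, hnf _ (Metric.mem_ball_self hpos) (subset_closure (h.mem i))⟩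
      ⟨z, hz, fun hzc => hzR (interior_subset (hnf z hz hzc))⟩
    exact hwc (subset_closure (interior_subset hwi))
  rw [Metric.mem_ball', add_comm] at hw
  obtain ⟨v, hv, hvw⟩ := exists_dist_le_lt (hr i).le (by linarith) hw
  exact absurd (h.boundary i v (by rwa [Metric.mem_closedBall']) w hwf) (not_le.2 hvw)

theorem WellDistributed.le_dist (h : WellDistributed R c r) (hr : ∀ i, 0 < r i) {i j : Fin n}
    (hij : i ≠ j) : r i + r j + 2 * maxRadius r ≤ dist (c i) (c j) := by
  have hm := (hr i).trans_le (le_maxRadius r i)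
  by_contra! hlt
  obtain ⟨v, hv, hvj⟩ := exists_dist_le_lt (hr i).le
    (show 0 < r j + 2 * maxRadius r by linarith [hr j])
    (show dist (c i) (c j) < r j + 2 * maxRadius r + r i by linarith)
  rw [dist_comm, add_comm] at hvj
  obtain ⟨w, hw, hwv⟩ := exists_dist_le_lt (hr j).le (by linarith) hvj
  refine absurd (h.agents i j hij v (by rwa [Metric.mem_closedBall']) w
    (by rwa [Metric.mem_closedBall'])) (not_le.2 ?_)
  rwa [dist_comm]

theorem maxDist_nonneg (A B : Set Plane) : 0 ≤ maxDist A B :=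
  Real.sSup_nonneg fun _ ⟨_, _, _, _, h⟩ => h ▸ dist_nonneg

theorem compDist_nonneg (A B : Set Plane) : 0 ≤ compDist A B := by
  unfold compDist
  split_ifs
  exacts [le_rfl, maxDist_nonneg A B]

/-- This includes `i = 0`, where the infimum is over an empty type and has the value `0`. -/
theorem prevDist_nonneg (R : Set Plane) (c : Fin n → Plane) (i : Fin n) : 0 ≤ prevDist R c i :=
  Real.iInf_nonneg fun _ => compDist_nonneg _ _

/-- Without boundedness the real `sSup` in `maxDist` would be the default `0`. -/
theorem bddAbove_image2_dist {A B : Set Plane} (hA : IsCompact A) (hB : IsCompact B) :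
    BddAbove (image2 dist A B) := by
  rw [← image_uncurry_prod]
  exact ((hA.prod hB).image continuous_dist).bddAbove

theorem dist_le_maxDist {A B A' B' : Set Plane} (hA : IsCompact A) (hB : IsCompact B)
    (hA' : A' ⊆ A) (hB' : B' ⊆ B) (hx : x ∈ A') (hy : y ∈ B') : dist x y ≤ maxDist A' B' :=
  le_csSup ((bddAbove_image2_dist hA hB).mono (image2_subset hA' hB')) (mem_image2_of_mem hx hy)

theorem maxDist_mono {A B A' B' : Set Plane} (hA : IsCompact A) (hB : IsCompact B)
    (hA' : A' ⊆ A) (hB' : B' ⊆ B) (hn : A'.Nonempty) (hn' : B'.Nonempty) :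
    maxDist A' B' ≤ maxDist A B :=
  csSup_le_csSup (bddAbove_image2_dist hA hB) (hn.image2 hn') (image2_subset hA' hB')

theorem agentComp_subset (R : Set Plane) (c : Fin n → Plane) (i : Fin n) : agentComp R c i ⊆ R :=
  pathComponentIn_subset

theorem mem_agentComp {i : Fin n} (h : c i ∈ R) : c i ∈ agentComp R c i :=
  mem_pathComponentIn_self h

theorem agentComp_mem_components {i : Fin n} (h : c i ∈ R) : agentComp R c i ∈ components R :=
  ⟨c i, h, rfl⟩

theorem exists_prevDist_eq [NeZero n] (R : Set Plane) (c : Fin n → Plane) {i : Fin n}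
    (hi : i ≠ 0) :
    ∃ j < i, prevDist R c i = compDist (agentComp R c i) (agentComp R c j) := by
  have : Nonempty (Iio i) := ⟨⟨0, Fin.pos_iff_ne_zero.2 hi⟩⟩
  obtain ⟨j, hj⟩ := exists_eq_ciInf_of_finite
    (f := fun j : Iio i => compDist (agentComp R c i) (agentComp R c j))
  exact ⟨j, j.2, hj.symm⟩

theorem prevDist_le [NeZero n] (R : Set Plane) (c : Fin n → Plane) {i : Fin n} (hi : i ≠ 0) :
    prevDist R c i ≤ compDist (agentComp R c i) (agentComp R c 0) :=
  ciInf_le (f := fun j : Iio i => compDist (agentComp R c i) (agentComp R c j))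
    (finite_range _).bddBelow ⟨0, Fin.pos_iff_ne_zero.2 hi⟩

open Classical in
/-- The tube of radius `ρ` between two positions of a region, unless they lie in the same
component. -/
noncomputable def connection (R : Set Plane) (c : Fin n → Plane) (ρ : ℝ) (i j : Fin n) :
    Set Plane :=
  if agentComp R c i = agentComp R c j then ∅ else Metric.thickening ρ (segment ℝ (c i) (c j))

theorem isOpen_connection (R : Set Plane) (c : Fin n → Plane) (ρ : ℝ) (i j : Fin n) :
    IsOpen (connection R c ρ i j) := by
  unfold connection
  split_ifs
  exacts [isOpen_empty, Metric.isOpen_thickening]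

theorem dist_le_compDist (hR : IsCompact R) (hc : ∀ i, c i ∈ R) {i j : Fin n}
    (h : agentComp R c i ≠ agentComp R c j) :
    dist (c i) (c j) ≤ compDist (agentComp R c i) (agentComp R c j) := by
  rw [compDist, if_neg h]
  exact dist_le_maxDist hR hR (agentComp_subset R c i) (agentComp_subset R c j)
    (mem_agentComp (hc i)) (mem_agentComp (hc j))

theorem volume_tube_sdiff_le {ρ l : ℝ} (hρ : 0 < ρ) (hx : Metric.ball x ρ ⊆ V)
    (hy : Metric.ball y ρ ⊆ V) (hl : dist x y ≤ l) :
    volume (Metric.thickening ρ (segment ℝ x y) \ V) ≤ ENNReal.ofReal (2 * l * ρ) :=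
  (measure_mono (sdiff_subset_sdiff_right (union_subset hx hy))).trans
    ((volume_tube_le x y hρ).trans (ENNReal.ofReal_le_ofReal (by gcongr)))

theorem volume_connection_le (hR : IsCompact R) (hc : ∀ i, c i ∈ R) {ρ : ℝ} (hρ : 0 < ρ)
    (hb : ∀ i, Metric.ball (c i) ρ ⊆ V) (i j : Fin n) :
    volume (connection R c ρ i j \ V) ≤
      ENNReal.ofReal (2 * compDist (agentComp R c i) (agentComp R c j) * ρ) := by
  unfold connection
  split_ifs with h
  · simp
  · exact volume_tube_sdiff_le hρ (hb i) (hb j) (dist_le_compDist hR hc h)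

/-- From any position of a region one can travel to the first one, when every component is
connected with an earlier component. -/
theorem travels_to_first [NeZero n] {ρ : ℝ} {par : Fin n → Fin n} (hR : IsCompact R)
    (hc : ∀ i, c i ∈ R) (hb : ∀ i, Metric.ball (c i) ρ ⊆ R) (hw : WideEnough R ρ)
    (hpar : ∀ i ≠ 0, par i < i ∧
      prevDist R c i = compDist (agentComp R c i) (agentComp R c (par i)))
    (hF : {z | Metric.ball z ρ ⊆ R} ⊆ F ∩ V)
    (hseg : ∀ i ≠ 0, agentComp R c i ≠ agentComp R c (par i) →
      segment ℝ (c i) (c (par i)) ⊆ F) (i : Fin n) :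
    Travels F V (c i) (c 0) (∑ j ∈ Finset.Ioc 0 i, prevDist R c j) := by
  induction i using WellFoundedLT.induction with
  | ind i ih =>
    have hcF : ∀ i, c i ∈ F ∩ V := fun i => hF (hb i)
    rcases eq_or_ne i 0 with rfl | hi
    · simpa using Travels.refl (hcF 0).1 (hcF 0).2
    obtain ⟨hlt, hd⟩ := hpar i hi
    have hstep : Travels F V (c i) (c (par i)) (prevDist R c i) := by
      by_cases he : agentComp R c i = agentComp R c (par i)
      · have hj : JoinedIn R (c i) (c (par i)) := by
          have : c (par i) ∈ agentComp R c i := he ▸ mem_agentComp (hc _)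
          exact this
        exact (Travels.of_joinedIn ((hw _ _ (hb _) (hb _) hj).mono hF)).mono Subset.rfl
          (prevDist_nonneg R c i)
      · exact (Travels.segment (hseg i hi he)).mono Subset.rfl
          (hd ▸ dist_le_compDist hR hc he)
    refine (hstep.trans (ih _ hlt) (hcF _).2).mono Subset.rfl ?_
    -- The link of `i` is new: the path from the parent is charged only to indices up to `par i <
    -- i`.
    have hmem : i ∉ Finset.Ioc 0 (par i) := fun h => absurd (Finset.mem_Ioc.1 h).2 (not_le.2 hlt)
    rw [← Finset.sum_insert hmem]
    refine Finset.sum_le_sum_of_subset_of_nonneg (fun j hj => ?_)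
      fun j _ _ => prevDist_nonneg R c j
    rcases Finset.mem_insert.1 hj with rfl | hj
    · exact Finset.mem_Ioc.2 ⟨Fin.pos_iff_ne_zero.2 hi, le_rfl⟩
    · exact Finset.mem_Ioc.2 ⟨(Finset.mem_Ioc.1 hj).1, (Finset.mem_Ioc.1 hj).2.trans hlt.le⟩

end

/-! ### Scheduling, moving the obstacles, and assembly -/

section

variable {R : Set Plane} {x y : Plane} {n : ℕ}

/-- If every agent can travel while the other agents wait at their starts or destinations, then
the agents can carry out their tasks one after another. -/
theorem exists_carriesOutTasks {E Δ : Set Plane} {s d : Fin n → Plane} {r ℓ : Fin n → ℝ} {ρ : ℝ}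
    (hrρ : ∀ i, r i ≤ ρ)
    (h : ∀ i, Travels ({z | Metric.ball z ρ ⊆ E \ Δ} ∩
      {z | ∀ j ≠ i, r j + ρ ≤ dist z (s j) ∧ r j + ρ ≤ dist z (d j)}) R (s i) (d i) (ℓ i)) :
    ∃ p : Fin n → ℝ≥0 → Plane, CarriesOutTasks E Δ s d r p ∧
      ∀ i, lengthOutside R (p i) ≤ ENNReal.ofReal (ℓ i) := by
  choose T γ f hT hγ hF h0 h1 hf hf0 hfL hc using h
  -- A common slot length: agent `i` moves only during `[i * M, (i + 1) * M]`.
  set M : ℝ := ∑ i, T i with hM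
  have hTM : ∀ i, T i ≤ M := fun i => Finset.single_le_sum (fun j _ => hT j) (Finset.mem_univ i)
  have hM0 : 0 ≤ M := Finset.sum_nonneg fun j _ => hT j
  have key : ∀ i j, i < j → ∀ t : ℝ,
      r i + r j ≤ dist (γ i (t - (i : ℕ) * M)) (γ j (t - (j : ℕ) * M)) := fun i j hij t => by
    -- Either `j` has not left its start, or `i`, whose slot is earlier, has already arrived.
    rcases le_total t ((j : ℕ) * M) with ht | ht
    · rw [h0 j _ (by linarith)]
      have := ((hF i (t - (i : ℕ) * M)).2 j hij.ne').1
      linarith [hrρ i]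
    · have hij' : ((i : ℕ) : ℝ) + 1 ≤ (j : ℕ) := by exact_mod_cast hij
      have hmul := mul_le_mul_of_nonneg_right hij' hM0
      rw [h1 i _ (by linarith [hTM i]), dist_comm]
      have := ((hF j (t - (j : ℕ) * M)).2 i hij.ne).2
      linarith [hrρ j]
  refine ⟨fun i t => γ i (t - (i : ℕ) * M), ⟨fun i => ?_, fun i => ?_, fun i => ?_,
    fun i t => ?_, fun i t z hz => ?_, fun i j hij t => ?_⟩,
    fun i => lengthOutside_le (hf i) (hf0 i) (hfL i) (hc i) _⟩
  · exact (hγ i).comp (by fun_prop)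
  · refine h0 i _ ?_
    have : 0 ≤ ((i : ℕ) : ℝ) * M := by positivity
    simpa using this
  · refine ⟨Real.toNNReal (M + (i : ℕ) * M), fun t ht => h1 i _ ?_⟩
    linarith [Real.toNNReal_le_iff_le_coe.1 ht, hTM i]
  · exact (Metric.ball_subset_ball (hrρ i)).trans ((hF i _).1.trans sdiff_subset)
  · by_contra! hlt
    refine ((hF i (t - (i : ℕ) * M)).1 (Metric.mem_ball'.2 (hlt.trans_le (hrρ i)))).2 hz
  · rcases lt_or_gt_of_ne hij with hlt | hlt
    · exact key i j hlt t
    · have := key j i hlt t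
      rw [dist_comm]
      linarith

/-- Tubes between positions in the regions stay in the environment. -/
theorem IsEnvironment.tube_subset {E S D Δ : Set Plane} (hE : IsEnvironment E S D Δ) {ρ : ℝ}
    (hx : Metric.ball x ρ ⊆ S ∪ D) (hy : Metric.ball y ρ ⊆ S ∪ D) :
    Metric.thickening ρ (segment ℝ x y) ⊆ E := by
  intro z hz
  obtain ⟨w, hw, hzw⟩ := Metric.mem_thickening_iff.1 hz
  -- Translation by `z - w` moves both ends within their balls and carries `w` to `z`, so `z` lies
  -- on a segment between points of `S ∪ D`.
  have hv : ∀ a : Plane, (z - w) + a ∈ Metric.ball a ρ := fun a => by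
    rwa [Metric.mem_ball, dist_eq_norm, add_sub_cancel_right, ← dist_eq_norm]
  refine hE.segment_subset _ (hx (hv x)) _ (hy (hv y)) ?_
  have := mem_segment_translate ℝ (z - w) (x := w) (b := x) (c := y)
  have := this.2 hw
  rwa [sub_add_cancel] at this

/-- The obstacle region can be moved away from a set when enough area is left. -/
theorem IsEnvironment.exists_obstacle {E S D Δ W : Set Plane} (hE : IsEnvironment E S D Δ)
    (hW : MeasurableSet W) (hWE : W ⊆ E) {a : ℝ} (hWa : volume (W \ (S ∪ D)) ≤ ENNReal.ofReal a)
    (ha : ENNReal.ofReal a ≤ volume (E \ (Δ ∪ S ∪ D))) :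
    ∃ Δ' : Set Plane, MeasurableSet Δ' ∧ Δ' ⊆ E \ (S ∪ D) ∧ Disjoint Δ' W ∧
      volume Δ' = volume Δ := by
  have hV : MeasurableSet (S ∪ D) :=
    hE.isCompact_start.measurableSet.union hE.isCompact_dest.measurableSet
  have hA : MeasurableSet ((E \ (S ∪ D)) \ W) := (hE.measurableSet.diff hV).diff hW
  obtain ⟨B, hBA, hB, hBv⟩ := exists_subset_volume_eq hA (v := volume Δ) (by
    have h1 : volume (E \ (S ∪ D)) = volume ((E \ (S ∪ D)) \ W) + volume (W \ (S ∪ D)) := by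
      rw [← measure_sdiff_add_inter (E \ (S ∪ D)) hW]
      congr 2
      ext z
      exact ⟨fun h => ⟨h.2, h.1.2⟩, fun h => ⟨⟨hWE h.1, h.2⟩, h.1⟩⟩
    have h2 : volume (E \ (S ∪ D)) = volume (E \ (Δ ∪ S ∪ D)) + volume Δ := by
      rw [← measure_sdiff_add_inter (E \ (S ∪ D)) hE.measurableSet_obstacle]
      congr 2
      · ext z; simp only [mem_sdiff, mem_union]; tauto
      · ext z
        refine ⟨fun h => h.2, fun h => ⟨⟨hE.obstacle_subset h, ?_⟩, h⟩⟩
        rintro (hz | hz)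
        exacts [hE.start_obstacle.le_bot ⟨hz, h⟩, hE.dest_obstacle.le_bot ⟨hz, h⟩]
    -- `E` may have infinite area, so the inequality is obtained by adding the finite area of `W \
    -- (S ∪ D)` instead of subtracting.
    refine (ENNReal.add_le_add_iff_right (hWa.trans_lt ENNReal.ofReal_lt_top).ne).1 ?_
    rw [← h1, h2, add_comm (volume Δ)]
    exact add_le_add_left (hWa.trans ha) _)
  exact ⟨B, hB, hBA.trans sdiff_subset, disjoint_left.2 fun z hz => (hBA hz).2, hBv⟩

/-- Agent `0` competes in every minimum, so `ComponentsSeparated` bounds each later pair of links by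
`firstDist`, and this by `maxDist S D`; there are `n` terms. -/
theorem prioritizedArea_le [NeZero n] {E S D Δ : Set Plane} {s d : Fin n → Plane}
    {r : Fin n → ℝ} (hE : IsEnvironment E S D Δ) (hr : ∀ i, 0 < r i) (hs : ∀ i, s i ∈ S)
    (hd : ∀ i, d i ∈ D) (hSD : ComponentsSeparated S D) :
    prioritizedArea S D s d r ≤ 2 * n * maxDist S D * maxRadius r := by
  have hm : 0 ≤ maxRadius r := (hr 0).le.trans (le_maxRadius r 0)
  have hfirst : firstDist S D s d ≤ maxDist S D :=
    maxDist_mono hE.isCompact_start hE.isCompact_dest (agentComp_subset S s 0)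
      (agentComp_subset D d 0) ⟨_, mem_agentComp (hs 0)⟩ ⟨_, mem_agentComp (hd 0)⟩
  have hprev : ∀ i ≠ 0, prevDist S s i + prevDist D d i ≤ maxDist S D := fun i hi =>
    ((add_le_add (prevDist_le S s hi) (prevDist_le D d hi)).trans
      (hSD _ (agentComp_mem_components (hs i)) _ (agentComp_mem_components (hs 0))
        _ (agentComp_mem_components (hd i)) _ (agentComp_mem_components (hd 0))
        _ (agentComp_mem_components (hs 0)) _ (agentComp_mem_components (hd 0)))).trans hfirst
  have hsum : ∑ i ∈ Finset.Ioi (0 : Fin n), 2 * (prevDist S s i + prevDist D d i) * maxRadius r ≤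
      (n - 1 : ℝ) * (2 * maxDist S D * maxRadius r) := by
    refine (Finset.sum_le_card_nsmul _ _ (2 * maxDist S D * maxRadius r) fun i hi => ?_).trans_eq ?_
    · have := hprev i (Finset.mem_Ioi.1 hi).ne'
      gcongr
    · rw [Fin.card_Ioi, nsmul_eq_mul, Fin.val_zero, Nat.sub_zero,
        Nat.cast_sub (Nat.one_le_iff_ne_zero.2 (NeZero.ne n)), Nat.cast_one]
  have h1 : 2 * firstDist S D s d * maxRadius r ≤ 2 * maxDist S D * maxRadius r := by gcongr
  unfold prioritizedArea
  linarith

theorem travelBound_mono [NeZero n] (S D : Set Plane) (s d : Fin n → Plane) :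
    Monotone (travelBound S D s d) := fun i j hij => by
  unfold travelBound
  gcongr
  refine fun k _ _ => add_nonneg (prevDist_nonneg S s k) (prevDist_nonneg D d k)

/-- Some rearrangement of the obstacles lets all agents pass. -/
theorem exists_rearrangement [NeZero n] {E S D Δ : Set Plane} {s d : Fin n → Plane}
    {r : Fin n → ℝ} (hE : IsEnvironment E S D Δ) (hr : ∀ i, 0 < r i)
    (hs : WellDistributed S s r) (hd : WellDistributed D d r)
    (hS : WideEnough S (maxRadius r)) (hD : WideEnough D (maxRadius r))
    (ha : ENNReal.ofReal (prioritizedArea S D s d r) ≤ volume (E \ (Δ ∪ S ∪ D))) :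
    ∃ Δ' : Set Plane, MeasurableSet Δ' ∧ Δ' ⊆ E \ (S ∪ D) ∧ volume Δ' = volume Δ ∧
      ∃ p : Fin n → ℝ≥0 → Plane, CarriesOutTasks E Δ' s d r p ∧
        ∀ i, lengthOutside (S ∪ D) (p i) ≤ ENNReal.ofReal (travelBound S D s d i) := by
  classical
  set ρ := maxRadius r with hρdef
  have hrρ : ∀ i, r i ≤ ρ := le_maxRadius r
  have hρ : 0 < ρ := (hr 0).trans_le (hrρ 0)
  have hsb' := hs.ball_subset hr
  have hdb' := hd.ball_subset hr
  have hsb : ∀ i, Metric.ball (s i) ρ ⊆ S := fun i =>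
    (Metric.ball_subset_ball (by linarith [hr i])).trans (hsb' i)
  have hdb : ∀ i, Metric.ball (d i) ρ ⊆ D := fun i =>
    (Metric.ball_subset_ball (by linarith [hr i])).trans (hdb' i)
  have hsV : ∀ i, Metric.ball (s i) ρ ⊆ S ∪ D := fun i => (hsb i).trans subset_union_left
  have hdV : ∀ i, Metric.ball (d i) ρ ⊆ S ∪ D := fun i => (hdb i).trans subset_union_right
  choose! ps hps using fun i (hi : i ≠ (0 : Fin n)) => exists_prevDist_eq S s hi
  choose! pd hpd using fun i (hi : i ≠ (0 : Fin n)) => exists_prevDist_eq D d hi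
  set W₀ := Metric.thickening ρ (segment ℝ (s 0) (d 0)) with hW₀
  set W₁ : Fin n → Set Plane := fun i => connection S s ρ i (ps i) ∪ connection D d ρ i (pd i)
    with hW₁
  set W := W₀ ∪ ⋃ i ∈ Finset.Ioi (0 : Fin n), W₁ i with hW
  have hWo : IsOpen W := Metric.isOpen_thickening.union (isOpen_biUnion fun i _ =>
    (isOpen_connection ..).union (isOpen_connection ..))
  have hconE : ∀ (R : Set Plane) (c : Fin n → Plane), (∀ i, Metric.ball (c i) ρ ⊆ S ∪ D) →
      ∀ i j, connection R c ρ i j ⊆ E := fun R c hb i j => by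
    unfold connection
    split_ifs
    exacts [empty_subset _, hE.tube_subset (hb i) (hb j)]
  have hWE : W ⊆ E := union_subset (hE.tube_subset (hsV 0) (hdV 0))
    (iUnion₂_subset fun i _ => union_subset (hconE S s hsV _ _) (hconE D d hdV _ _))
  have hfirst : dist (s 0) (d 0) ≤ firstDist S D s d :=
    dist_le_maxDist hE.isCompact_start hE.isCompact_dest (agentComp_subset S s 0)
      (agentComp_subset D d 0) (mem_agentComp (hs.mem 0)) (mem_agentComp (hd.mem 0))
  have hfirst0 : 0 ≤ firstDist S D s d := maxDist_nonneg _ _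
  have hWv : volume (W \ (S ∪ D)) ≤ ENNReal.ofReal (prioritizedArea S D s d r) := by
    have hns := prevDist_nonneg S s
    have hnd := prevDist_nonneg D d
    have h0 : volume (W₀ \ (S ∪ D)) ≤ ENNReal.ofReal (2 * firstDist S D s d * ρ) :=
      volume_tube_sdiff_le hρ (hsV 0) (hdV 0) hfirst
    have h1 : ∀ i ∈ Finset.Ioi (0 : Fin n), volume (W₁ i \ (S ∪ D)) ≤
        ENNReal.ofReal (2 * (prevDist S s i + prevDist D d i) * ρ) := fun i hi => by
      have hi0 := (Finset.mem_Ioi.1 hi).ne'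
      have e1 := volume_connection_le hE.isCompact_start hs.mem hρ hsV i (ps i)
      have e2 := volume_connection_le hE.isCompact_dest hd.mem hρ hdV i (pd i)
      rw [← (hps i hi0).2] at e1
      rw [← (hpd i hi0).2] at e2
      have := hns i
      have := hnd i
      rw [union_sdiff_distrib, mul_add, add_mul, ENNReal.ofReal_add (by positivity) (by positivity)]
      exact (measure_union_le _ _).trans (add_le_add e1 e2)
    rw [prioritizedArea, ENNReal.ofReal_add (by positivity)
      (Finset.sum_nonneg fun i _ => by have := hns i; have := hnd i; positivity),
      ENNReal.ofReal_sum_of_nonneg (fun i _ => by have := hns i; have := hnd i; positivity),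
      hW, union_sdiff_distrib]
    simp only [iUnion_sdiff]
    exact (measure_union_le _ _).trans (add_le_add h0
      ((measure_biUnion_finset_le _ _).trans (Finset.sum_le_sum h1)))
  obtain ⟨Δ', hΔm, hΔE, hΔW, hΔv⟩ := hE.exists_obstacle hWo.measurableSet hWE hWv ha
  refine ⟨Δ', hΔm, hΔE, hΔv, exists_carriesOutTasks hrρ fun i => ?_⟩
  set F : Set Plane := {z | Metric.ball z ρ ⊆ E \ Δ'} with hF
  have hVF : ∀ z, Metric.ball z ρ ⊆ S ∪ D → z ∈ F ∩ (S ∪ D) := fun z hz =>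
    ⟨fun w hw => ⟨(union_subset hE.start_subset hE.dest_subset) (hz hw),
      fun hwΔ => (hΔE hwΔ).2 (hz hw)⟩, hz (Metric.mem_ball_self hρ)⟩
  have hsegF : ∀ x y, Metric.thickening ρ (segment ℝ x y) ⊆ W → segment ℝ x y ⊆ F :=
    fun x y hxy z hz w hw => by
      have : w ∈ W := hxy (Metric.mem_thickening_iff.2 ⟨z, hz, hw⟩)
      exact ⟨hWE this, fun hwΔ => hΔW.le_bot ⟨hwΔ, this⟩⟩
  have hW₁W : ∀ i ≠ 0, W₁ i ⊆ W := fun i hi =>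
    subset_union_of_subset_right
      (subset_biUnion_of_mem (u := W₁) (Finset.mem_coe.2 (Finset.mem_Ioi.2
        (Fin.pos_iff_ne_zero.2 hi)))) _
  have hts := travels_to_first (F := F) (V := S ∪ D) hE.isCompact_start hs.mem hsb hS hps
    (fun z hz => hVF z (hz.trans subset_union_left)) (fun i hi hne => hsegF _ _ (by
      refine Subset.trans ?_ ((subset_union_left (t := connection D d ρ i (pd i))).trans
        (hW₁W i hi))
      rw [connection, if_neg hne])) i
  have htd := travels_to_first (F := F) (V := S ∪ D) hE.isCompact_dest hd.mem hdb hD hpd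
    (fun z hz => hVF z (hz.trans subset_union_right)) (fun i hi hne => hsegF _ _ (by
      refine Subset.trans ?_ ((subset_union_right (s := connection S s ρ i (ps i))).trans
        (hW₁W i hi))
      rw [connection, if_neg hne])) i
  have htsd : Travels F (S ∪ D) (s 0) (d 0) (firstDist S D s d) :=
    (Travels.segment (hsegF _ _ subset_union_left)).mono Subset.rfl hfirst
  have htravel : Travels F (S ∪ D) (s i) (d i) (travelBound S D s d i) :=
    ((hts.trans htsd (.inl (hs.mem 0))).trans htd.symm (.inr (hd.mem 0))).mono Subset.rfl (by
      rw [travelBound, Finset.sum_add_distrib]; linarith)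
  -- The two balls lie in the disjoint sets `S` and `D`, and disjoint balls have centres at least
  -- the sum of the radii apart.
  have hsd : ∀ j k, r j + ρ + (r k + ρ) ≤ dist (s j) (d k) := fun j k => by
    refine (disjoint_ball_ball_iff (by linarith [hr j]) (by linarith [hr k])).1 ?_
    refine hE.start_dest.mono ((Metric.ball_subset_ball ?_).trans (hsb' j))
      ((Metric.ball_subset_ball ?_).trans (hdb' k)) <;> linarith
  -- All `2 * n` resting places, each with the radius `q` that the centre of a moving disk of radius
  -- `ρ` must keep away from.
  set c : Fin n ⊕ Fin n → Plane := Sum.elim s d with hc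
  set q : Fin n ⊕ Fin n → ℝ := Sum.elim (fun j => r j + ρ) (fun j => r j + ρ) with hq
  have hcc : ∀ k l, k ≠ l → q k + q l ≤ dist (c k) (c l) := by
    rintro (j | j) (k | k) hjk
    · have := hs.le_dist hr (show j ≠ k from fun e => hjk (e ▸ rfl))
      simp only [hc, hq, Sum.elim_inl]; linarith
    · exact hsd j k
    · simp only [hc, hq, Sum.elim_inl, Sum.elim_inr]
      rw [dist_comm, add_comm]; exact hsd k j
    · have := hd.le_dist hr (show j ≠ k from fun e => hjk (e ▸ rfl))
      simp only [hc, hq, Sum.elim_inr]; linarith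
  have hq0 : ∀ k, 0 ≤ q k := by
    rintro (j | j) <;> simp only [hq, Sum.elim_inl, Sum.elim_inr] <;> linarith [hr j]
  -- Here the full clearance `2 * maxRadius r` is used: a disk of radius `ρ` circling a resting
  -- agent stays in `S ∪ D`, hence clear of the obstacles.
  have hcb : ∀ k, Metric.ball (c k) (q k + ρ) ⊆ S ∪ D := by
    rintro (j | j)
    · exact (Metric.ball_subset_ball (by simp only [hq, Sum.elim_inl]; linarith)).trans
        ((hsb' j).trans subset_union_left)
    · exact (Metric.ball_subset_ball (by simp only [hq, Sum.elim_inr]; linarith)).trans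
        ((hdb' j).trans subset_union_right)
  have hout : ∀ k l, k ≠ l → c k ∉ Metric.ball (c l) (q l) := fun k l hkl hm => by
    linarith [hcc k l hkl, Metric.mem_ball.1 hm, hq0 k]
  refine (htravel.avoid_balls (c := c) (ρ := q) {k | k ≠ .inl i ∧ k ≠ .inr i} (fun k _ => hq0 k)
    (fun k _ z hz => hVF z ?_) (fun k _ l _ hkl => ?_) (fun k hk => ?_) fun k hk => ?_).mono ?_ le_rfl
  · refine (Metric.ball_subset_ball' ?_).trans (hcb k)
    rw [Metric.mem_sphere.1 hz, add_comm]
  · refine disjoint_left.2 fun z hz hz' => ?_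
    have := hcc k l hkl
    have h2 := dist_triangle_left (c k) (c l) z
    rw [Metric.mem_sphere.1 hz] at h2
    linarith [Metric.mem_ball.1 hz']
  · exact hout (.inl i) k (Finset.mem_filter.1 hk).2.1.symm
  · exact hout (.inr i) k (Finset.mem_filter.1 hk).2.2.symm
  · rintro z ⟨hzF, hz⟩
    simp only [mem_iUnion, not_exists] at hz
    refine ⟨hzF, fun j hj => ⟨?_, ?_⟩⟩
    · exact not_lt.1 (hz (.inl j) (by simpa using hj))
    · exact not_lt.1 (hz (.inr j) (by simpa using hj))

end

end EnvOpt

theorem theorem3 (n : ℕ) [NeZero n] (E S D Δ : Set EnvOpt.Plane)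
    (s d : Fin n → EnvOpt.Plane) (r : Fin n → ℝ) (ρ : Fin n → ℝ)
    (hE : EnvOpt.IsEnvironment E S D Δ)
    (hr : ∀ i, 0 < r i)
    (hs : EnvOpt.WellDistributed S s r)
    (hd : EnvOpt.WellDistributed D d r)
    (hS : EnvOpt.WideEnough S (EnvOpt.maxRadius r))
    (hD : EnvOpt.WideEnough D (EnvOpt.maxRadius r))
    (hSD : EnvOpt.ComponentsSeparated S D)
    (hρ : ∀ i j, i ≤ j → ρ j ≤ ρ i) :
    -- offline completeness with bounded travelled distances
    (ENNReal.ofReal (EnvOpt.prioritizedArea S D s d r) ≤ volume (E \ (Δ ∪ S ∪ D)) →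
      ∃ Δ' : Set EnvOpt.Plane, MeasurableSet Δ' ∧ Δ' ⊆ E \ (S ∪ D) ∧ volume Δ' = volume Δ ∧
        ∃ p : Fin n → ℝ≥0 → EnvOpt.Plane, EnvOpt.CarriesOutTasks E Δ' s d r p ∧
          ∀ i, EnvOpt.lengthOutside (S ∪ D) (p i) ≤
            ENNReal.ofReal (EnvOpt.travelBound S D s d i)) ∧
    -- the required area does not exceed the unprioritized one
    EnvOpt.prioritizedArea S D s d r ≤ 2 * n * EnvOpt.maxDist S D * EnvOpt.maxRadius r ∧
    -- the bounds do not decrease as the priority decreases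
    (∀ i j, i ≤ j → EnvOpt.travelBound S D s d i ≤ EnvOpt.travelBound S D s d j) ∧
    (∀ i j, ρ j < ρ i → EnvOpt.travelBound S D s d i ≤ EnvOpt.travelBound S D s d j) := by
  refine ⟨fun ha => EnvOpt.exists_rearrangement hE hr hs hd hS hD ha,
    EnvOpt.prioritizedArea_le hE hr hs.mem hd.mem hSD,
    fun i j hij => EnvOpt.travelBound_mono S D s d hij, fun i j hij => ?_⟩
  refine EnvOpt.travelBound_mono S D s d (le_of_not_ge fun hji => ?_)
  exact absurd (hρ j i hji) (not_le.2 hij)
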